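/- Let $\Sigma$ be a complete simplicial fan in $\mathbb R^n$ whose rays have primitive generators ${\bf v}_1,\dots,{\bf v}_r\in\mathbb Z^n$, and let $\phi:\mathbb Z^n\to\mathbb Z^r$, $\phi({\bf m})=(\langle {\bf m},{\bf v}_1\rangle,\dots,\langle {\bf m},{\bf v}_r\rangle)$. Assume that the class group of the toric variety $X=X_\Sigma$ is free, i.e. that there is an exact sequence $$0\to\mathbb Z^n\xrightarrow{\ \phi\ }\mathbb Z^r\xrightarrow{\ \beta\ }\mathbb Z^d\to 0,$$ and put $L_\beta=\phi(\mathbb Z^n)=\ker\beta$. Let $S=\mathbb F_q[x_1,\dots,x_r]$ be the Cox ring over a finite field $\mathbb F_q$, graded by $\mathbb Z^d$ via $\deg x_j=\beta({\bf e}_j)$, and let $\overline{\mathbb F}_q$ be an algebraic closure of $\mathbb F_q$. Let $B\subset S$ be the ideal generated by the monomials $\prod_{{\bf v}_i\notin\sigma}x_i$ for $\sigma\in\Sigma$, and let $$G=\Big\{g\in(\overline{\mathbb F}_q^{\,*})^r : \prod_{i=1}^r g_i^{({\bf v}_i)_j}=1 \text{ for } j=1,\dots,n\Big\}.$$ Identify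 $X$ with the set of $G$-orbits $[P]$ of points $P\in\overline{\mathbb F}_q^{\,r}\setminus V(B)$. Let $X(\mathbb F_q)$ be the set of the orbits $[P]$ with $P\in\mathbb F_q^{\,r}\setminus V(B)$, and let $T_X=(\overline{\mathbb F}_q^{\,*})^r/G\subset X$. For an ideal $J\subset S$ put $$V_{X(\mathbb F_q)}(J)=\{[P]\in X(\mathbb F_q) : F(P)=0\text{ for every homogeneous }F\in J\}.$$ For $Y\subset X$ let the vanishing ideal $I(Y)\subset S$ be the ideal generated by the homogeneous polynomials in $S$ vanishing at all points of $Y$. For a subgroup $L\subseteq\mathbb Z^r$ let $$I_L=\langle {\bf x}^{{\bf m}^+}-{\bf x}^{{\bf m}^-} : {\bf m}={\bf m}^+-{\bf m}^-\in L\rangle\subset S,$$ where ${\bf m}^+$ and ${\bf m}^-$ are the positive and negative parts of ${\bf m}$. Let $L\subseteq L_\beta$ be any subgroup (of arbitrary rank) and put $L'=L+(q-1)L_\beta$. Then the vanishing ideal of $V_{X(\mathbb F_q)}(I_L)\cap T_X$ is $I_{L'}$: $$I\big(V_{X(\mathbb F_q)}(I_L)\cap T_X\big)=I_{L'}.$$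 Moreover, $V_{X(\mathbb F_q)}(I_L)\cap T_X$ is finite and its order (number of elements) is $|L_\beta/L'|$. -/

import Mathlib

noncomputable section

/-- The vector of `ℝⁿ` underlying a lattice vector of `ℤⁿ`. -/
def latticeVec {n : ℕ} (w : Fin n → ℤ) : Fin n → ℝ := fun j => (w j : ℝ)

/-- A (finite, nonempty) fan in `ℝⁿ`: a finite collection of strongly convex rational polyhedral
cones, closed under taking faces, any two of which meet in a common face. -/
structure ToricFan (n : ℕ) where
  /-- the cones of the fan -/
  cones : Set (PointedCone ℝ (Fin n → ℝ))
  finite_cones : cones.Finite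
  nonempty_cones : cones.Nonempty
  rational : ∀ σ ∈ cones, ∃ S : Finset (Fin n → ℤ),
    σ = PointedCone.hull ℝ (latticeVec '' (S : Set (Fin n → ℤ)))
  stronglyConvex : ∀ σ ∈ cones, ∀ x ∈ σ, -x ∈ σ → x = 0
  face_mem : ∀ σ ∈ cones, ∀ τ : PointedCone ℝ (Fin n → ℝ), τ.IsFaceOf σ → τ ∈ cones
  inf_isFaceOf : ∀ σ ∈ cones, ∀ τ ∈ cones, (σ ⊓ τ).IsFaceOf σ ∧ (σ ⊓ τ).IsFaceOf τ

namespace ToricFan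

/-- The support of the fan is all of `ℝⁿ`. -/
def IsComplete {n : ℕ} (F : ToricFan n) : Prop := ∀ x : Fin n → ℝ, ∃ σ ∈ F.cones, x ∈ σ

/-- Every cone of the fan is generated by linearly independent vectors. -/
def IsSimplicial {n : ℕ} (F : ToricFan n) : Prop := ∀ σ ∈ F.cones, PointedCone.IsSimplicial σ

/-- `v₁, …, v_r` are the primitive generators of the rays (one-dimensional cones) of the fan,
each ray being listed exactly once. -/
structure IsRayGenerators {n r : ℕ} (F : ToricFan n) (v : Fin r → Fin n → ℤ) : Prop where
  injective : Function.Injective v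
  primitive : ∀ i, Finset.univ.gcd (v i) = 1
  mem_rays_iff : ∀ τ : PointedCone ℝ (Fin n → ℝ),
    (τ ∈ F.cones ∧ Module.finrank ℝ (Submodule.span ℝ (τ : Set (Fin n → ℝ))) = 1) ↔
      ∃ i, τ = PointedCone.hull ℝ {latticeVec (v i)}

end ToricFan

section Toric

variable {n r d : ℕ}

/-- The map `φ : ℤⁿ → ℤʳ`, `m ↦ (⟨m, v₁⟩, …, ⟨m, v_r⟩)`. -/
def rayMap (v : Fin r → Fin n → ℤ) : (Fin n → ℤ) →+ (Fin r → ℤ) where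
  toFun m := fun i => ∑ j, v i j * m j
  map_zero' := by
    funext i
    simp
  map_add' m m' := by
    funext i
    simp [mul_add, Finset.sum_add_distrib]

/-- The lattice `L_β = φ(ℤⁿ) ⊆ ℤʳ`. -/
def relationLattice (v : Fin r → Fin n → ℤ) : AddSubgroup (Fin r → ℤ) := (rayMap v).range

/-- The grading of the Cox ring by `ℤᵈ`: the degree of `x_j` is the `j`-th column of `β`. -/
def coxDegree (β : (Fin r → ℤ) →+ (Fin d → ℤ)) : Fin r → (Fin d → ℤ) :=
  fun j => β (Pi.single j 1)

/-- A polynomial is homogeneous if all its monomials have the same degree. -/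
def IsCoxHomogeneous {K : Type*} [Field K] (β : (Fin r → ℤ) →+ (Fin d → ℤ))
    (f : MvPolynomial (Fin r) K) : Prop :=
  ∃ α : Fin d → ℤ, MvPolynomial.IsWeightedHomogeneous (coxDegree β) f α

/-- The lattice ideal `I_L`, generated by the binomials `x^{m⁺} - x^{m⁻}` for `m ∈ L`. -/
def latticeIdeal (K : Type*) [Field K] (L : AddSubgroup (Fin r → ℤ)) :
    Ideal (MvPolynomial (Fin r) K) :=
  Ideal.span {f | ∃ m ∈ L, f =
    ∏ i, MvPolynomial.X i ^ (m i).toNat - ∏ i, MvPolynomial.X i ^ (-m i).toNat}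

open Classical in
/-- The irrelevant ideal `B`, generated by the monomials `∏_{ρ_i ⊄ σ} x_i` for the cones `σ` of the
fan. -/
def irrelevantIdeal (K : Type*) [Field K] (F : ToricFan n) (v : Fin r → Fin n → ℤ) :
    Ideal (MvPolynomial (Fin r) K) :=
  Ideal.span {f | ∃ σ ∈ F.cones, f =
    ∏ i ∈ Finset.univ.filter (fun i => latticeVec (v i) ∉ σ), MvPolynomial.X i}

/-- The group `G = ker π`, where `π : (kˣ)ʳ → (kˣ)ⁿ` is given by the columns `u₁, …, u_n` of `φ`,
i.e. `π(g)_j = ∏_i g_i ^ (v_i)_j`. -/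
def coxGroup (k : Type*) [Field k] (v : Fin r → Fin n → ℤ) : Subgroup (Fin r → kˣ) where
  carrier := {g | ∀ j, ∏ i, g i ^ v i j = 1}
  one_mem' := by
    intro j
    simp
  mul_mem' := by
    intro a b ha hb j
    simp [mul_zpow, Finset.prod_mul_distrib, ha j, hb j]
  inv_mem' := by
    intro a ha j
    simp [ha j]

variable (K : Type*) [Field K]

/-- The complement `K̄ʳ ∖ V(B)`, where `K̄` is an algebraic closure of `K`. -/
abbrev CoxOpen (F : ToricFan n) (v : Fin r → Fin n → ℤ) : Type _ :=
  {P : Fin r → AlgebraicClosure K //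
    P ∉ MvPolynomial.zeroLocus (AlgebraicClosure K) (irrelevantIdeal K F v)}

/-- Two points of `K̄ʳ ∖ V(B)` are equivalent if they lie in the same `G`-orbit. -/
def coxSetoid (F : ToricFan n) (v : Fin r → Fin n → ℤ) : Setoid (CoxOpen K F v) where
  r P Q := ∃ g ∈ coxGroup (AlgebraicClosure K) v, ∀ i, P.1 i = (g i : AlgebraicClosure K) * Q.1 i
  iseqv :=
    { refl := fun P => ⟨1, one_mem _, fun i => by simp⟩
      symm := by
        rintro P Q ⟨g, hg, h⟩
        exact ⟨g⁻¹, inv_mem hg, fun i => by simp [h i]⟩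
      trans := by
        rintro P Q R ⟨g, hg, h⟩ ⟨g', hg', h'⟩
        exact ⟨g * g', mul_mem hg hg', fun i => by simp [h i, h' i, mul_assoc]⟩ }

/-- The toric variety `X`, through its `K̄`-points: the quotient `(K̄ʳ ∖ V(B)) / G`. -/
def ToricPoints (F : ToricFan n) (v : Fin r → Fin n → ℤ) : Type _ := Quotient (coxSetoid K F v)

/-- The point `[P]` of `X`. -/
def toricMk (F : ToricFan n) (v : Fin r → Fin n → ℤ) (P : CoxOpen K F v) : ToricPoints K F v :=
  Quotient.mk (coxSetoid K F v) P

/-- The `K`-rational points `X(K)`: the points `[P]` with `P ∈ Kʳ ∖ V(B)`. -/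
def rationalPoints (F : ToricFan n) (v : Fin r → Fin n → ℤ) : Set (ToricPoints K F v) :=
  {x | ∃ P : CoxOpen K F v, toricMk K F v P = x ∧
    ∃ p : Fin r → K, ∀ i, P.1 i = algebraMap K (AlgebraicClosure K) (p i)}

/-- The torus `T_X = (K̄ˣ)ʳ / G ⊆ X`. -/
def torusPoints (F : ToricFan n) (v : Fin r → Fin n → ℤ) : Set (ToricPoints K F v) :=
  {x | ∃ P : CoxOpen K F v, toricMk K F v P = x ∧ ∀ i, P.1 i ≠ 0}

variable {K}

/-- The polynomial `f` vanishes at the point `x = [P]` of `X`. For homogeneous `f` this does not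
depend on the representative `P`, see `vanishesAt_toricMk`. -/
def VanishesAt {F : ToricFan n} {v : Fin r → Fin n → ℤ} (f : MvPolynomial (Fin r) K)
    (x : ToricPoints K F v) : Prop :=
  ∀ P : CoxOpen K F v, toricMk K F v P = x → MvPolynomial.aeval P.1 f = 0

/-- Homogeneity makes vanishing at `[P]` independent of the representative `P`. -/
theorem vanishesAt_toricMk {F : ToricFan n} {v : Fin r → Fin n → ℤ}
    {β : (Fin r → ℤ) →+ (Fin d → ℤ)} (hexact : Function.Exact (rayMap v) β)
    {f : MvPolynomial (Fin r) K} (hf : IsCoxHomogeneous β f) (P : CoxOpen K F v) :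
    VanishesAt f (toricMk K F v P) ↔ MvPolynomial.aeval P.1 f = 0 := by
  refine ⟨fun h => h P rfl, fun h Q hQ => ?_⟩
  obtain ⟨g, hg, hgi⟩ : ∃ g ∈ coxGroup (AlgebraicClosure K) v,
      ∀ i, Q.1 i = (g i : AlgebraicClosure K) * P.1 i := Quotient.exact hQ
  obtain ⟨α, hα⟩ := hf
  have hβ (a : Fin r →₀ ℕ) :
      Finsupp.weight (coxDegree β) a = β (fun i => (a i : ℤ)) := by
    have h1 : (fun i => (a i : ℤ)) = ∑ i, a i • (Pi.single i (1 : ℤ) : Fin r → ℤ) := by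
      funext j
      simp [Finset.sum_apply, Pi.single_apply]
    rw [h1, map_sum, Finsupp.weight_apply, Finsupp.sum_fintype _ _ (by simp)]
    simp only [map_nsmul, coxDegree]
  have hchar (a b : Fin r →₀ ℕ) (ha : f.coeff a ≠ 0) (hb : f.coeff b ≠ 0) :
      ∏ i, g i ^ a i = ∏ i, g i ^ b i := by
    have h0 : β (fun i => (a i : ℤ) - b i) = 0 := by
      have h1 := (hα ha).trans (hα hb).symm
      rw [hβ, hβ] at h1
      change β ((fun i => (a i : ℤ)) - fun i => (b i : ℤ)) = 0
      rw [map_sub, h1, sub_self]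
    obtain ⟨m, hm⟩ := (hexact _).1 h0
    have h2 : ∏ i, g i ^ ((a i : ℤ) - b i) = 1 := by
      have h3 (i : Fin r) : g i ^ ((a i : ℤ) - b i) = ∏ j, (g i ^ v i j) ^ m j := by
        rw [← congrFun hm i]
        change g i ^ (∑ j, v i j * m j) = _
        simp only [← zpow_mul]
        induction (Finset.univ : Finset (Fin n)) using Finset.induction_on with
        | empty => simp
        | insert x s hx ih => rw [Finset.sum_insert hx, Finset.prod_insert hx, zpow_add, ih]
      simp only [h3]
      rw [Finset.prod_comm]
      refine Finset.prod_eq_one fun j _ => ?_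
      rw [Finset.prod_zpow, hg j, one_zpow]
    simp only [zpow_sub, zpow_natCast, Finset.prod_mul_distrib, Finset.prod_inv_distrib] at h2
    exact mul_inv_eq_one.1 h2
  by_cases hf0 : f = 0
  · simp [hf0]
  obtain ⟨b, hb⟩ := MvPolynomial.ne_zero_iff.1 hf0
  have key : MvPolynomial.aeval Q.1 f =
      ((∏ i, g i ^ b i : (AlgebraicClosure K)ˣ) : AlgebraicClosure K) *
        MvPolynomial.aeval P.1 f := by
    rw [MvPolynomial.aeval_eq_eval₂Hom, MvPolynomial.coe_eval₂Hom, MvPolynomial.eval₂_eq',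
      MvPolynomial.aeval_eq_eval₂Hom, MvPolynomial.coe_eval₂Hom, MvPolynomial.eval₂_eq',
      Finset.mul_sum]
    refine Finset.sum_congr rfl fun a ha => ?_
    rw [← hchar a b (MvPolynomial.mem_support_iff.1 ha) hb]
    simp only [hgi, mul_pow, Finset.prod_mul_distrib]
    push_cast
    ring
  rw [key, h, mul_zero]

/-- `V_{X(K)}(J)`: the `K`-rational points of `X` at which all homogeneous `f ∈ J` vanish. -/
def rationalZeros (F : ToricFan n) (v : Fin r → Fin n → ℤ) (β : (Fin r → ℤ) →+ (Fin d → ℤ))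
    (J : Ideal (MvPolynomial (Fin r) K)) : Set (ToricPoints K F v) :=
  {x | x ∈ rationalPoints K F v ∧ ∀ f ∈ J, IsCoxHomogeneous β f → VanishesAt f x}

/-- The vanishing ideal `I(Y)`, generated by the homogeneous polynomials in `K[x₁, …, x_r]` which
vanish at all points of `Y`. -/
def toricVanishingIdeal {F : ToricFan n} {v : Fin r → Fin n → ℤ}
    (β : (Fin r → ℤ) →+ (Fin d → ℤ)) (Y : Set (ToricPoints K F v)) :
    Ideal (MvPolynomial (Fin r) K) :=
  Ideal.span {f | IsCoxHomogeneous β f ∧ ∀ x ∈ Y, VanishesAt f x}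

end Toric

end

/-! A rational torus point has coordinates p in (Kˣ)ʳ, and modulo G it is determined by the
character m ↦ p^m of L_β. Since ℤᵈ is free, β splits and L_β is a direct summand of ℤʳ, so every
character L_β → Kˣ arises this way. The binomials of I_L vanish at p exactly when the character is
trivial on L; it is always trivial on (q-1)L_β because |Kˣ| = q-1. Hence the set in question is
Hom(L_β/L', Kˣ). The group L_β/L' is finitely generated and killed by q-1, hence finite, and Kˣ
contains enough roots of unity for it to have as many characters as elements.

For the ideal, the exponents of a homogeneous f differ by elements of ker β = L_β. Dividing f by one
of its monomials gives a combination of elements of L_β, and f vanishes on the set when all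
characters of L_β/L' annihilate its image in K[L_β/L']. Linear independence of characters, applied
to the evaluations on the dual group (`sum_smul_eq_zero_of_forall_monoidHom`), makes that image
zero. The coefficients of f then sum to zero in each class modulo L', so f is a combination of
differences of monomials with exponents congruent modulo L', each of which lies in I_{L'}. -/

noncomputable section

/-! ### Laurent monomials, lattice binomials and the splitting of L_β -/

section Laurent

variable {r n d : ℕ}

/-- The value at a point `p` of the torus of the Laurent monomial with exponent vector `m`. -/
def laurentEval {k : Type*} [Field k] (p : Fin r → kˣ) :
    Multiplicative (Fin r → ℤ) →* kˣ where
  toFun m := ∏ i, p i ^ m.toAdd i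
  map_one' := by simp
  map_mul' a b := by simp [zpow_add, Finset.prod_mul_distrib]

theorem laurentEval_ofAdd {k : Type*} [Field k] (p : Fin r → kˣ) (m : Fin r → ℤ) :
    laurentEval p (.ofAdd m) = ∏ i, p i ^ m i := rfl

/-- ℤʳ is free on the unit vectors, so a character is a torus point; this turns characters into
coordinates. -/
theorem laurentEval_eq_of_apply_single {k : Type*} [Field k]
    (ψ : Multiplicative (Fin r → ℤ) →* kˣ) :
    laurentEval (fun i => ψ (.ofAdd (Pi.single i 1))) = ψ := by
  refine MonoidHom.ext fun m => ?_
  have h1 : m = .ofAdd (∑ i, m.toAdd i • (Pi.single i (1 : ℤ) : Fin r → ℤ)) := by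
    apply Multiplicative.toAdd.injective
    funext j
    simp [Finset.sum_apply, Pi.single_apply]
  conv_rhs => rw [h1, ofAdd_sum, map_prod]
  simp only [laurentEval, ofAdd_zsmul, map_zpow, MonoidHom.coe_mk, OneHom.coe_mk]

theorem laurentEval_mul {k : Type*} [Field k] (p s : Fin r → kˣ)
    (m : Multiplicative (Fin r → ℤ)) :
    laurentEval (p * s) m = laurentEval p m * laurentEval s m := by
  simp [laurentEval, mul_zpow, Finset.prod_mul_distrib]

theorem laurentEval_inv {k : Type*} [Field k] (p : Fin r → kˣ)
    (m : Multiplicative (Fin r → ℤ)) :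
    laurentEval p⁻¹ m = (laurentEval p m)⁻¹ := by
  simp [laurentEval]

theorem laurentEval_map {k k' : Type*} [Field k] [Field k'] (f : kˣ →* k'ˣ) (p : Fin r → kˣ)
    (m : Multiplicative (Fin r → ℤ)) :
    laurentEval (fun i => f (p i)) m = f (laurentEval p m) := by
  simp [laurentEval]

/-- The equations defining G are the conditions for m = φ(e_j), and these vectors generate L_β. -/
theorem mem_coxGroup_iff_laurentEval {k : Type*} [Field k] (v : Fin r → Fin n → ℤ)
    (g : Fin r → kˣ) :
    g ∈ coxGroup k v ↔ ∀ m ∈ relationLattice v, laurentEval g (.ofAdd m) = 1 := by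
  constructor
  · rintro hg _ ⟨m, rfl⟩
    have h3 (i : Fin r) : g i ^ (rayMap v m i) = ∏ j, (g i ^ v i j) ^ m j := by
      change g i ^ (∑ j, v i j * m j) = _
      simp only [← zpow_mul]
      induction (Finset.univ : Finset (Fin n)) using Finset.induction_on with
      | empty => simp
      | insert x s hx ih => rw [Finset.sum_insert hx, Finset.prod_insert hx, zpow_add, ih]
    rw [laurentEval_ofAdd]
    simp only [h3]
    rw [Finset.prod_comm]
    exact Finset.prod_eq_one fun j _ => by rw [Finset.prod_zpow, hg j, one_zpow]
  · intro h j
    have := h (rayMap v (Pi.single j 1)) ⟨_, rfl⟩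
    rw [laurentEval_ofAdd] at this
    rw [← this]
    refine Finset.prod_congr rfl fun i _ => ?_
    congr 1
    change _ = ∑ j', v i j' * (Pi.single j (1 : ℤ) : Fin n → ℤ) j'
    simp [Pi.single_apply]

theorem laurentEval_eq_iff_natPow {k : Type*} [Field k] (p : Fin r → kˣ) (m : Fin r → ℤ) :
    laurentEval p (.ofAdd m) = 1 ↔
      ∏ i, p i ^ (m i).toNat = ∏ i, p i ^ (-m i).toNat := by
  have h : laurentEval p (.ofAdd m) =
      (∏ i, p i ^ (m i).toNat) * (∏ i, p i ^ (-m i).toNat)⁻¹ := by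
    rw [laurentEval_ofAdd, ← Finset.prod_inv_distrib, ← Finset.prod_mul_distrib]
    refine Finset.prod_congr rfl fun i _ => ?_
    rw [← zpow_natCast, ← zpow_natCast, ← zpow_neg, ← zpow_add]
    congr 1
    omega
  rw [h, mul_inv_eq_one]

/-- The binomial `x^{m⁺} - x^{m⁻}`. -/
def latticeBinomial (K : Type*) [Field K] (m : Fin r → ℤ) : MvPolynomial (Fin r) K :=
  ∏ i, MvPolynomial.X i ^ (m i).toNat - ∏ i, MvPolynomial.X i ^ (-m i).toNat

theorem latticeBinomial_mem {K : Type*} [Field K] {L : AddSubgroup (Fin r → ℤ)}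
    {m : Fin r → ℤ} (hm : m ∈ L) : latticeBinomial K m ∈ latticeIdeal K L :=
  Ideal.subset_span ⟨m, hm, rfl⟩

theorem aeval_latticeBinomial {K k : Type*} [Field K] [Field k] [Algebra K k]
    (p : Fin r → kˣ) (m : Fin r → ℤ) :
    MvPolynomial.aeval (fun i => (p i : k)) (latticeBinomial K m) = 0 ↔
      laurentEval p (.ofAdd m) = 1 := by
  rw [laurentEval_eq_iff_natPow, ← Units.val_inj]
  simp [latticeBinomial, sub_eq_zero]

theorem aeval_eq_zero_of_mem_latticeIdeal {K k : Type*} [Field K] [Field k] [Algebra K k]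
    {L : AddSubgroup (Fin r → ℤ)} {p : Fin r → kˣ}
    (h : ∀ m ∈ L, laurentEval p (.ofAdd m) = 1) {f : MvPolynomial (Fin r) K}
    (hf : f ∈ latticeIdeal K L) : MvPolynomial.aeval (fun i => (p i : k)) f = 0 := by
  have : latticeIdeal K L ≤ RingHom.ker (MvPolynomial.aeval (R := K) (fun i => (p i : k))) := by
    refine Ideal.span_le.2 ?_
    rintro _ ⟨m, hm, rfl⟩
    exact (aeval_latticeBinomial p m).2 (h m hm)
  exact this hf

theorem weight_coxDegree (β : (Fin r → ℤ) →+ (Fin d → ℤ)) (a : Fin r →₀ ℕ) :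
    Finsupp.weight (coxDegree β) a = β (fun i => (a i : ℤ)) := by
  have h1 : (fun i => (a i : ℤ)) = ∑ i, a i • (Pi.single i (1 : ℤ) : Fin r → ℤ) := by
    funext j
    simp [Finset.sum_apply, Pi.single_apply]
  rw [h1, map_sum, Finsupp.weight_apply, Finsupp.sum_fintype _ _ (by simp)]
  simp only [map_nsmul, coxDegree]

theorem prod_X_pow_eq_monomial {K : Type*} [Field K] (a : Fin r → ℕ) :
    ∏ i, (MvPolynomial.X i : MvPolynomial (Fin r) K) ^ a i =
      MvPolynomial.monomial (Finsupp.equivFunOnFinite.symm a) 1 := by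
  rw [MvPolynomial.monomial_eq, Finsupp.prod_fintype _ _ (by simp)]
  simp

theorem isCoxHomogeneous_latticeBinomial {K : Type*} [Field K]
    {β : (Fin r → ℤ) →+ (Fin d → ℤ)} {m : Fin r → ℤ} (hm : β m = 0) :
    IsCoxHomogeneous β (latticeBinomial K m) := by
  refine ⟨β (fun i => ((m i).toNat : ℤ)), ?_⟩
  rw [latticeBinomial, prod_X_pow_eq_monomial, prod_X_pow_eq_monomial]
  refine Submodule.sub_mem (MvPolynomial.weightedHomogeneousSubmodule K (coxDegree β) _)
    (MvPolynomial.isWeightedHomogeneous_monomial _ _ _ (weight_coxDegree _ _))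
    (MvPolynomial.isWeightedHomogeneous_monomial _ _ _ ?_)
  rw [weight_coxDegree, ← sub_eq_zero, ← map_sub, ← neg_eq_zero, ← map_neg]
  convert hm using 2
  funext i
  simp only [Finsupp.equivFunOnFinite_symm_apply_apply, Pi.neg_apply, Pi.sub_apply]
  omega

/-- Factoring out the common part x^{min(a,b)} leaves the binomial of a - b. -/
theorem monomial_sub_monomial_mem_latticeIdeal {K : Type*} [Field K]
    {L : AddSubgroup (Fin r → ℤ)} (a b : Fin r →₀ ℕ)
    (h : (fun i => (a i : ℤ) - b i) ∈ L) :
    MvPolynomial.monomial a (1 : K) - MvPolynomial.monomial b 1 ∈ latticeIdeal K L := by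
  have key (a b : Fin r →₀ ℕ) :
      a = a ⊓ b + Finsupp.equivFunOnFinite.symm (fun i => ((a i : ℤ) - b i).toNat) := by
    ext i
    simp only [Finsupp.add_apply, Finsupp.inf_apply, Finsupp.equivFunOnFinite_symm_apply_apply]
    omega
  have : MvPolynomial.monomial a (1 : K) - MvPolynomial.monomial b 1 =
      MvPolynomial.monomial (a ⊓ b) 1 * latticeBinomial K (fun i => (a i : ℤ) - b i) := by
    rw [latticeBinomial, prod_X_pow_eq_monomial, prod_X_pow_eq_monomial, mul_sub,
      MvPolynomial.monomial_mul, MvPolynomial.monomial_mul, mul_one, ← key a b]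
    simp only [neg_sub]
    rw [inf_comm a b, ← key b a]
  rw [this]
  exact Ideal.mul_mem_left _ _ (latticeBinomial_mem h)

/-- The kernel of a surjection onto `ℤᵈ` is a direct summand. -/
theorem exists_retraction_of_exact {v : Fin r → Fin n → ℤ} {β : (Fin r → ℤ) →+ (Fin d → ℤ)}
    (hβ : Function.Surjective β) (hexact : Function.Exact (rayMap v) β) :
    ∃ ρ : (Fin r → ℤ) →+ relationLattice v, ∀ a : relationLattice v, ρ a = a := by
  obtain ⟨s, hs⟩ := Module.projective_lifting_property β.toIntLinearMap
    (LinearMap.id (R := ℤ) (M := Fin d → ℤ)) hβ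
  have hs' (y) : β (s y) = y := LinearMap.congr_fun hs y
  have hmem (x) : x - s (β x) ∈ relationLattice v := by
    obtain ⟨m, hm⟩ := (hexact (x - s (β x))).1 (by rw [map_sub, hs', sub_self])
    exact ⟨m, hm⟩
  refine ⟨(AddMonoidHom.id _ - s.toAddMonoidHom.comp β).codRestrict _ hmem, fun a => ?_⟩
  have ha : β a = 0 := by
    obtain ⟨_, m, hm⟩ := a
    exact (hexact _).2 ⟨m, hm⟩
  apply Subtype.ext
  change (a : Fin r → ℤ) - s (β a) = a
  rw [ha, map_zero, sub_zero]

end Laurent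

/-! ### Roots of unity in a finite field -/

section FiniteField

theorem hasEnoughRootsOfUnity_of_exponent_dvd (K : Type*) [Field K] [Fintype K] {e : ℕ}
    (he : e ∣ Fintype.card K - 1) : HasEnoughRootsOfUnity K e := by
  classical
  have hpos : 0 < Fintype.card K - 1 := Nat.sub_pos_of_lt Fintype.one_lt_card
  have : NeZero (Fintype.card K - 1) := ⟨hpos.ne'⟩
  have : HasEnoughRootsOfUnity K (Fintype.card K - 1) := by
    refine HasEnoughRootsOfUnity.of_card_le ?_
    -- Every unit of K is a (q-1)-th root of unity, so there are q-1 of them.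
    have htop : rootsOfUnity (Fintype.card K - 1) K = ⊤ := by
      ext x
      simp only [mem_rootsOfUnity, Subgroup.mem_top, iff_true]
      rw [← Fintype.card_units, pow_card_eq_one]
    rw [htop, Nat.card_congr Subgroup.topEquiv.toEquiv, Nat.card_eq_fintype_card,
      Fintype.card_units]
  exact HasEnoughRootsOfUnity.of_dvd K he

end FiniteField

/-! ### Duality for finite abelian groups -/

section Duality

variable {ι G K V : Type*} [CommGroup G] [Finite G] [Field K]

/-- A relation between the values of all characters of a finite abelian group holds between the
values of any function on the group. -/
theorem sum_smul_eq_zero_of_forall_monoidHom [HasEnoughRootsOfUnity K (Monoid.exponent G)]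
    [AddCommGroup V] [Module K V] (s : Finset ι) (c : ι → K) (κ : ι → G)
    (hc : ∀ χ : G →* Kˣ, ∑ a ∈ s, c a * (χ (κ a) : K) = 0) (h : G → V) :
    ∑ a ∈ s, c a • h (κ a) = 0 := by
  -- Elements of G become characters of the dual group; they stay distinct because characters
  -- separate points, so Dedekind's theorem makes them independent.
  let ev : G → ((G →* Kˣ) →* K) := fun x => (Units.coeHom K).comp (MonoidHom.eval x)
  have hinj : Function.Injective ev := fun x y hxy =>
    CommGroup.forall_apply_eq_apply_iff (M := K) G |>.1 fun χ =>
      Units.ext (DFunLike.congr_fun hxy χ)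
  have hli := (linearIndependent_monoidHom (G →* Kˣ) K).comp ev hinj
  have hw := linearIndependent_iff.1 hli (∑ a ∈ s, Finsupp.single (κ a) (c a)) (by
    funext χ
    simpa [ev] using hc χ)
  have := congrArg (Finsupp.linearCombination K h) hw
  simpa using this

end Duality

/-! ### Rational points of the torus -/

section TorusPoints

variable {n r d : ℕ} {K : Type*} [Field K]

/-- A point of the torus `(K̄ˣ)ʳ` as a point of `K̄ʳ ∖ V(B)`. -/
def coxOpenOfUnits (F : ToricFan n) (v : Fin r → Fin n → ℤ)
    (p : Fin r → (AlgebraicClosure K)ˣ) : CoxOpen K F v :=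
  ⟨fun i => p i, fun h => by
    classical
    -- The monomial in B of any one cone is nonzero on the torus.
    obtain ⟨σ, hσ⟩ := F.nonempty_cones
    have := h _ (Ideal.subset_span ⟨σ, hσ, rfl⟩)
    rw [map_prod, Finset.prod_eq_zero_iff] at this
    obtain ⟨i, _, hi⟩ := this
    simp at hi⟩

theorem toricMk_coxOpenOfUnits_eq_iff (F : ToricFan n) (v : Fin r → Fin n → ℤ)
    (p s : Fin r → (AlgebraicClosure K)ˣ) :
    toricMk K F v (coxOpenOfUnits F v p) = toricMk K F v (coxOpenOfUnits F v s) ↔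
      ∀ m ∈ relationLattice v, laurentEval p (.ofAdd m) = laurentEval s (.ofAdd m) := by
  constructor
  · intro h m hm
    obtain ⟨g, hg, hgi⟩ : ∃ g ∈ coxGroup (AlgebraicClosure K) v,
      ∀ i, (p i : AlgebraicClosure K) = (g i : AlgebraicClosure K) * s i := Quotient.exact h
    have hps : p = g * s := funext fun i => Units.ext (hgi i)
    rw [hps, laurentEval_mul, (mem_coxGroup_iff_laurentEval v g).1 hg m hm, one_mul]
  · intro h
    refine Quotient.sound ⟨p * s⁻¹, ?_, fun i => ?_⟩
    · rw [mem_coxGroup_iff_laurentEval]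
      intro m hm
      rw [laurentEval_mul, laurentEval_inv, h m hm, mul_inv_cancel]
    · simp [coxOpenOfUnits]

/-- The point of the toric variety with homogeneous coordinates `p ∈ (Kˣ)ʳ`. -/
def toricMkUnits (F : ToricFan n) (v : Fin r → Fin n → ℤ) (p : Fin r → Kˣ) :
    ToricPoints K F v :=
  toricMk K F v
    (coxOpenOfUnits F v fun i => Units.map (algebraMap K (AlgebraicClosure K)).toMonoidHom (p i))

/-- Orbits are taken over K̄, but Kˣ embeds in K̄ˣ, so equality can be tested over K. -/
theorem toricMkUnits_eq_iff (F : ToricFan n) (v : Fin r → Fin n → ℤ) (p s : Fin r → Kˣ) :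
    toricMkUnits F v p = toricMkUnits F v s ↔
      ∀ m ∈ relationLattice v, laurentEval p (.ofAdd m) = laurentEval s (.ofAdd m) := by
  simp only [toricMkUnits, toricMk_coxOpenOfUnits_eq_iff, laurentEval_map]
  have hinj := Units.map_injective
    (f := (algebraMap K (AlgebraicClosure K)).toMonoidHom) (algebraMap K _).injective
  simp only [hinj.eq_iff]

theorem vanishesAt_toricMkUnits {F : ToricFan n} {v : Fin r → Fin n → ℤ}
    {β : (Fin r → ℤ) →+ (Fin d → ℤ)} (hexact : Function.Exact (rayMap v) β)
    {f : MvPolynomial (Fin r) K} (hf : IsCoxHomogeneous β f) (p : Fin r → Kˣ) :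
    VanishesAt f (toricMkUnits F v p) ↔
      MvPolynomial.aeval (fun i => (p i : K)) f = 0 := by
  rw [toricMkUnits, vanishesAt_toricMk hexact hf]
  have : MvPolynomial.aeval (fun i => algebraMap K (AlgebraicClosure K) (p i)) f =
      algebraMap K (AlgebraicClosure K) (MvPolynomial.aeval (fun i => (p i : K)) f) :=
    MvPolynomial.aeval_algebraMap_apply _ _ _
  change MvPolynomial.aeval (fun i => algebraMap K (AlgebraicClosure K) (p i)) f = 0 ↔ _
  rw [this, map_eq_zero]

/-- The rational representative and the one with nonzero coordinates differ by units, so the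
rational one already lies in the torus. -/
theorem mem_rationalPoints_inter_torusPoints_iff (F : ToricFan n) (v : Fin r → Fin n → ℤ)
    (x : ToricPoints K F v) :
    x ∈ rationalPoints K F v ∩ torusPoints K F v ↔ ∃ p : Fin r → Kˣ, toricMkUnits F v p = x := by
  constructor
  · rintro ⟨⟨P, rfl, p, hp⟩, Q, hQP, hQ⟩
    obtain ⟨g, -, hgi⟩ : ∃ g ∈ coxGroup (AlgebraicClosure K) v,
      ∀ i, Q.1 i = (g i : AlgebraicClosure K) * P.1 i := Quotient.exact hQP
    have hne (i) : p i ≠ 0 := fun h0 => hQ i (by rw [hgi, hp, h0, map_zero, mul_zero])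
    refine ⟨fun i => Units.mk0 (p i) (hne i), congrArg (toricMk K F v) (Subtype.ext ?_)⟩
    funext i
    exact (hp i).symm
  · rintro ⟨p, rfl⟩
    exact ⟨⟨_, rfl, fun i => p i, fun i => rfl⟩, _, rfl, fun i => Units.ne_zero _⟩

/-- As L ≤ ker β, the generating binomials are homogeneous and so are among the equations tested. -/
theorem mem_rationalZeros_latticeIdeal_inter_torusPoints_iff
    {F : ToricFan n} {v : Fin r → Fin n → ℤ}
    {β : (Fin r → ℤ) →+ (Fin d → ℤ)} (hexact : Function.Exact (rayMap v) β)
    {L : AddSubgroup (Fin r → ℤ)} (hL : L ≤ relationLattice v) (x : ToricPoints K F v) :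
    x ∈ rationalZeros F v β (latticeIdeal K L) ∩ torusPoints K F v ↔
      ∃ p : Fin r → Kˣ, (∀ m ∈ L, laurentEval p (.ofAdd m) = 1) ∧ toricMkUnits F v p = x := by
  constructor
  · rintro ⟨⟨hrat, hvan⟩, htor⟩
    obtain ⟨p, rfl⟩ := (mem_rationalPoints_inter_torusPoints_iff F v x).1 ⟨hrat, htor⟩
    refine ⟨p, fun m hm => ?_, rfl⟩
    have hhom : IsCoxHomogeneous β (latticeBinomial K m) :=
      isCoxHomogeneous_latticeBinomial ((hexact m).2 (hL hm))
    exact (aeval_latticeBinomial (K := K) p m).1 ((vanishesAt_toricMkUnits hexact hhom p).1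
      (hvan _ (latticeBinomial_mem hm) hhom))
  · rintro ⟨p, hp, rfl⟩
    obtain ⟨hrat, htor⟩ := (mem_rationalPoints_inter_torusPoints_iff F v _).2 ⟨p, rfl⟩
    exact ⟨⟨hrat, fun f hf hhom => (vanishesAt_toricMkUnits hexact hhom p).2
      (aeval_eq_zero_of_mem_latticeIdeal hp hf)⟩, htor⟩

end TorusPoints

/-! ### Torus points as characters of L_β / L' -/

section Characters

variable {n r d : ℕ} {K : Type*} [Field K]

/-- The group `L_β / L'`, written multiplicatively. -/
abbrev LatticeQuotient (v : Fin r → Fin n → ℤ) (L' : AddSubgroup (Fin r → ℤ)) : Type :=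
  Multiplicative (relationLattice v ⧸ L'.addSubgroupOf (relationLattice v))

/-- The class in `L_β / L'` of an element of `L_β`. -/
def latticeClass (v : Fin r → Fin n → ℤ) (L' : AddSubgroup (Fin r → ℤ)) :
    Multiplicative (relationLattice v) →* LatticeQuotient v L' :=
  AddMonoidHom.toMultiplicative (QuotientAddGroup.mk' _)

theorem latticeClass_surjective (v : Fin r → Fin n → ℤ) (L' : AddSubgroup (Fin r → ℤ)) :
    Function.Surjective (latticeClass v L') :=
  QuotientAddGroup.mk'_surjective (L'.addSubgroupOf (relationLattice v))

theorem latticeClass_eq_one_iff {v : Fin r → Fin n → ℤ} {L' : AddSubgroup (Fin r → ℤ)}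
    (a : relationLattice v) : latticeClass v L' (.ofAdd a) = 1 ↔ (a : Fin r → ℤ) ∈ L' :=
  (QuotientAddGroup.eq_zero_iff (N := L'.addSubgroupOf (relationLattice v)) a).trans
    AddSubgroup.mem_addSubgroupOf

/-- A torus point whose Laurent monomials restrict on `L_β` to a given character of `L_β / L'`. -/
def characterPoint {v : Fin r → Fin n → ℤ} {L' : AddSubgroup (Fin r → ℤ)}
    (ρ : (Fin r → ℤ) →+ relationLattice v) (χ : LatticeQuotient v L' →* Kˣ) : Fin r → Kˣ :=
  fun i => χ (latticeClass v L' (.ofAdd (ρ (Pi.single i 1))))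

theorem laurentEval_characterPoint {v : Fin r → Fin n → ℤ} {L' : AddSubgroup (Fin r → ℤ)}
    {ρ : (Fin r → ℤ) →+ relationLattice v} (hρ : ∀ a : relationLattice v, ρ a = a)
    (χ : LatticeQuotient v L' →* Kˣ) (a : relationLattice v) :
    laurentEval (characterPoint ρ χ) (.ofAdd (a : Fin r → ℤ)) =
      χ (latticeClass v L' (.ofAdd a)) := by
  have := DFunLike.congr_fun (laurentEval_eq_of_apply_single
    (χ.comp ((latticeClass v L').comp (AddMonoidHom.toMultiplicative ρ))))
    (.ofAdd (a : Fin r → ℤ))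
  refine this.trans ?_
  change χ (latticeClass v L' (.ofAdd (ρ a))) = _
  rw [hρ]

/-- A torus point whose Laurent monomials are trivial on `L'` defines a character of `L_β / L'`. -/
theorem exists_character_of_laurentEval_eq_one {v : Fin r → Fin n → ℤ}
    {L' : AddSubgroup (Fin r → ℤ)} (p : Fin r → Kˣ)
    (hp : ∀ m ∈ L', laurentEval p (.ofAdd m) = 1) :
    ∃ χ : LatticeQuotient v L' →* Kˣ, ∀ a : relationLattice v,
      χ (latticeClass v L' (.ofAdd a)) = laurentEval p (.ofAdd (a : Fin r → ℤ)) := by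
  refine ⟨AddMonoidHom.toMultiplicativeLeft (QuotientAddGroup.lift _
    ((MonoidHom.toAdditiveRight (laurentEval p)).comp (relationLattice v).subtype)
    fun a ha => ?_), fun a => rfl⟩
  exact congrArg Additive.ofMul (hp _ (AddSubgroup.mem_addSubgroupOf.1 ha))

theorem range_toricMkUnits_characterPoint (F : ToricFan n) {v : Fin r → Fin n → ℤ}
    {L' : AddSubgroup (Fin r → ℤ)} (hL' : L' ≤ relationLattice v)
    {ρ : (Fin r → ℤ) →+ relationLattice v} (hρ : ∀ a : relationLattice v, ρ a = a) :
    Set.range (fun χ : LatticeQuotient v L' →* Kˣ => toricMkUnits F v (characterPoint ρ χ)) =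
      {x | ∃ p : Fin r → Kˣ, (∀ m ∈ L', laurentEval p (.ofAdd m) = 1) ∧
        toricMkUnits F v p = x} := by
  ext x
  constructor
  · rintro ⟨χ, rfl⟩
    refine ⟨_, fun m hm => ?_, rfl⟩
    rw [laurentEval_characterPoint hρ χ ⟨m, hL' hm⟩, (latticeClass_eq_one_iff _).2 hm, map_one]
  · rintro ⟨p, hp, rfl⟩
    obtain ⟨χ, hχ⟩ := exists_character_of_laurentEval_eq_one (v := v) p hp
    refine ⟨χ, (toricMkUnits_eq_iff F v _ _).2 fun m hm => ?_⟩
    rw [← hχ ⟨m, hm⟩]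
    exact laurentEval_characterPoint hρ χ ⟨m, hm⟩

theorem toricMkUnits_characterPoint_injective (F : ToricFan n) {v : Fin r → Fin n → ℤ}
    {L' : AddSubgroup (Fin r → ℤ)}
    {ρ : (Fin r → ℤ) →+ relationLattice v} (hρ : ∀ a : relationLattice v, ρ a = a) :
    Function.Injective
      (fun χ : LatticeQuotient v L' →* Kˣ => toricMkUnits F v (characterPoint ρ χ)) := by
  intro χ χ' h
  refine MonoidHom.ext fun y => ?_
  obtain ⟨a, rfl⟩ := latticeClass_surjective v L' y
  have := (toricMkUnits_eq_iff F v _ _).1 h _ a.toAdd.2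
  rwa [laurentEval_characterPoint hρ, laurentEval_characterPoint hρ] at this

/-- L_β is finitely generated as a subgroup of ℤʳ, and a finitely generated torsion group is finite.
-/
theorem finite_latticeQuotient {v : Fin r → Fin n → ℤ} {L' : AddSubgroup (Fin r → ℤ)} {e : ℕ}
    (he : 0 < e) (h : ∀ m ∈ relationLattice v, e • m ∈ L') : Finite (LatticeQuotient v L') := by
  have : Module.Finite ℤ (relationLattice v) :=
    inferInstanceAs (Module.Finite ℤ (AddSubgroup.toIntSubmodule (relationLattice v)))
  have : Module.Finite ℤ (relationLattice v ⧸ L'.addSubgroupOf (relationLattice v)) :=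
    Module.Finite.of_surjective (QuotientAddGroup.mk' _).toIntLinearMap
      (QuotientAddGroup.mk'_surjective (L'.addSubgroupOf (relationLattice v)))
  refine @Finite.of_equiv _ _ (Module.finite_of_fg_torsion _ ?_) Multiplicative.ofAdd
  intro x
  obtain ⟨a, rfl⟩ := QuotientAddGroup.mk_surjective x
  refine ⟨⟨(e : ℤ), mem_nonZeroDivisors_of_ne_zero (by omega)⟩, ?_⟩
  change (e : ℤ) • (a : relationLattice v ⧸ L'.addSubgroupOf (relationLattice v)) = 0
  rw [natCast_zsmul, ← QuotientAddGroup.mk_nsmul, QuotientAddGroup.eq_zero_iff]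
  exact AddSubgroup.mem_addSubgroupOf.2 (h _ a.2)

theorem exponent_latticeQuotient_dvd {v : Fin r → Fin n → ℤ} {L' : AddSubgroup (Fin r → ℤ)}
    {e : ℕ} (h : ∀ m ∈ relationLattice v, e • m ∈ L') :
    Monoid.exponent (LatticeQuotient v L') ∣ e := by
  refine Monoid.exponent_dvd_of_forall_pow_eq_one fun y => ?_
  obtain ⟨a, rfl⟩ := latticeClass_surjective v L' y
  rw [← map_pow]
  exact (latticeClass_eq_one_iff (e • a.toAdd)).2 (h _ a.toAdd.2)

end Characters

/-! ### Homogeneous polynomials vanishing at all character points -/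

section VanishingIdeal

variable {n r d : ℕ} {K : Type*} [Field K]

/-- Dividing by x^b moves the exponents of a homogeneous f into L_β, where characters of the
quotient can be evaluated. -/
theorem aeval_units_eq_sum (p : Fin r → Kˣ) (f : MvPolynomial (Fin r) K) (b : Fin r →₀ ℕ) :
    MvPolynomial.aeval (fun i => (p i : K)) f = (∏ i, (p i : K) ^ b i) *
      ∑ a ∈ f.support,
        f.coeff a * (laurentEval p (.ofAdd fun i => (a i : ℤ) - b i) : Kˣ) := by
  rw [MvPolynomial.aeval_eq_eval₂Hom, MvPolynomial.coe_eval₂Hom, MvPolynomial.eval₂_eq',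
    Finset.mul_sum]
  refine Finset.sum_congr rfl fun a _ => ?_
  have h : ∏ i, (p i : K) ^ a i = (∏ i, (p i : K) ^ b i) *
      (laurentEval p (.ofAdd fun i => (a i : ℤ) - b i) : Kˣ) := by
    have : ∏ i, p i ^ a i = (∏ i, p i ^ b i) *
        laurentEval p (.ofAdd fun i => (a i : ℤ) - b i) := by
      rw [laurentEval_ofAdd, ← Finset.prod_mul_distrib]
      refine Finset.prod_congr rfl fun i _ => ?_
      rw [← zpow_natCast, ← zpow_natCast, ← zpow_add]
      congr 1
      omega
    simpa using congrArg Units.val this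
  rw [h, Algebra.algebraMap_self, RingHom.id_apply]
  ring

theorem mem_latticeIdeal_of_forall_characterPoint {v : Fin r → Fin n → ℤ}
    {β : (Fin r → ℤ) →+ (Fin d → ℤ)} (hexact : Function.Exact (rayMap v) β)
    {L' : AddSubgroup (Fin r → ℤ)} [Finite (LatticeQuotient v L')]
    [HasEnoughRootsOfUnity K (Monoid.exponent (LatticeQuotient v L'))]
    {ρ : (Fin r → ℤ) →+ relationLattice v} (hρ : ∀ a : relationLattice v, ρ a = a)
    {f : MvPolynomial (Fin r) K} (hf : IsCoxHomogeneous β f)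
    (hvan : ∀ χ : LatticeQuotient v L' →* Kˣ,
      MvPolynomial.aeval (fun i => (characterPoint ρ χ i : K)) f = 0) :
    f ∈ latticeIdeal K L' := by
  obtain ⟨α, hα⟩ := hf
  by_cases hf0 : f = 0
  · rw [hf0]
    exact zero_mem _
  obtain ⟨b, hb⟩ := MvPolynomial.ne_zero_iff.1 hf0
  have hmem (a) (ha : a ∈ f.support) : (fun i => (a i : ℤ) - b i) ∈ relationLattice v := by
    refine (hexact _).1 ?_
    change β ((fun i => (a i : ℤ)) - fun i => (b i : ℤ)) = 0
    rw [map_sub, ← weight_coxDegree, ← weight_coxDegree, hα (MvPolynomial.mem_support_iff.1 ha),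
      hα hb, sub_self]
  let κ : (Fin r →₀ ℕ) → LatticeQuotient v L' :=
    fun a => latticeClass v L' (.ofAdd (ρ fun i => (a i : ℤ) - b i))
  have hρ' (a) (ha : a ∈ f.support) :
      ((ρ fun i => (a i : ℤ) - b i : relationLattice v) : Fin r → ℤ) =
        fun i => (a i : ℤ) - b i :=
    congrArg Subtype.val (hρ ⟨_, hmem a ha⟩)
  have hsum (χ : LatticeQuotient v L' →* Kˣ) :
      ∑ a ∈ f.support, f.coeff a * (χ (κ a) : K) = 0 := by
    have h := hvan χ
    rw [aeval_units_eq_sum _ f b] at h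
    have hne : ∏ i, (characterPoint ρ χ i : K) ^ b i ≠ 0 :=
      Finset.prod_ne_zero_iff.2 fun i _ => pow_ne_zero _ (Units.ne_zero _)
    rw [← (mul_eq_zero.1 h).resolve_left hne]
    refine Finset.sum_congr rfl fun a ha => ?_
    rw [← hρ' a ha, laurentEval_characterPoint hρ]
  -- choose a monomial of `f` in every class
  let c : LatticeQuotient v L' → (Fin r →₀ ℕ) :=
    fun y => Function.invFunOn κ (f.support : Set (Fin r →₀ ℕ)) y
  have hc (a) (ha : a ∈ f.support) : c (κ a) ∈ f.support ∧ κ (c (κ a)) = κ a :=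
    ⟨Function.invFunOn_mem (s := (f.support : Set (Fin r →₀ ℕ))) ⟨a, ha, rfl⟩,
      Function.invFunOn_eq (s := (f.support : Set (Fin r →₀ ℕ))) ⟨a, ha, rfl⟩⟩
  -- Replacing each monomial of f by its class representative gives zero, so these representatives
  -- may be subtracted from f.
  have hzero := sum_smul_eq_zero_of_forall_monoidHom f.support (fun a => f.coeff a) κ hsum
    (fun y => (MvPolynomial.monomial (c y) (1 : K)))
  have hfsum : f = ∑ a ∈ f.support, f.coeff a •
      (MvPolynomial.monomial a (1 : K) - MvPolynomial.monomial (c (κ a)) 1) := by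
    simp only [smul_sub, Finset.sum_sub_distrib]
    rw [hzero, sub_zero]
    conv_lhs => rw [f.as_sum]
    simp [MvPolynomial.smul_monomial]
  rw [hfsum]
  refine Ideal.sum_mem _ fun a ha => ?_
  rw [MvPolynomial.smul_eq_C_mul]
  refine Ideal.mul_mem_left _ _ (monomial_sub_monomial_mem_latticeIdeal _ _ ?_)
  obtain ⟨hca, hκ⟩ := hc a ha
  have h1 : latticeClass v L' (.ofAdd ((ρ fun i => (a i : ℤ) - b i) -
      ρ fun i => (c (κ a) i : ℤ) - b i)) = 1 := by
    rw [ofAdd_sub, map_div, div_eq_one]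
    exact hκ.symm
  rw [latticeClass_eq_one_iff, AddSubgroup.coe_sub, hρ' _ ha, hρ' _ hca] at h1
  convert h1 using 1
  funext i
  simp

end VanishingIdeal

end

/-! ### The vanishing ideal and the number of points -/

open scoped Pointwise in
theorem corollaryc {n r d : ℕ}
    (F : ToricFan n) (hcomplete : F.IsComplete) (hsimplicial : F.IsSimplicial)
    (v : Fin r → Fin n → ℤ) (hv : F.IsRayGenerators v)
    (β : (Fin r → ℤ) →+ (Fin d → ℤ)) (hβ : Function.Surjective β)
    (hexact : Function.Exact (rayMap v) β)
    (K : Type*) [Field K] [Fintype K]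
    (L : AddSubgroup (Fin r → ℤ)) (hL : L ≤ relationLattice v)
    (L' : AddSubgroup (Fin r → ℤ))
    (hL' : L' = L ⊔ ((Fintype.card K : ℤ) - 1) • relationLattice v)
    (Y : Set (ToricPoints K F v))
    (hY : Y = rationalZeros F v β (latticeIdeal K L) ∩ torusPoints K F v) :
    toricVanishingIdeal β Y = latticeIdeal K L' ∧
      Y.Finite ∧
      Y.ncard = Nat.card (relationLattice v ⧸ L'.addSubgroupOf (relationLattice v)) := by
  classical
  obtain ⟨ρ, hρ⟩ := exists_retraction_of_exact hβ hexact
  have hcard : ((Fintype.card K - 1 : ℕ) : ℤ) = (Fintype.card K : ℤ) - 1 := by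
    rw [Nat.cast_sub Fintype.card_pos, Nat.cast_one]
  have hLL' : L ≤ L' := hL' ▸ le_sup_left
  have hpow (m) (hm : m ∈ relationLattice v) : (Fintype.card K - 1) • m ∈ L' := by
    rw [hL', ← natCast_zsmul, hcard]
    exact AddSubgroup.mem_sup_right (AddSubgroup.smul_mem_pointwise_smul _ _ _ hm)
  have hL'A : L' ≤ relationLattice v := by
    rw [hL']
    refine sup_le hL ?_
    rintro _ ⟨m, hm, rfl⟩
    exact zsmul_mem hm _
  have htriv (p : Fin r → Kˣ) (hp : ∀ m ∈ L, laurentEval p (.ofAdd m) = 1) :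
      ∀ m ∈ L', laurentEval p (.ofAdd m) = 1 := by
    intro m hm
    rw [hL'] at hm
    obtain ⟨l, hl, _, ⟨a, -, rfl⟩, rfl⟩ := AddSubgroup.mem_sup.1 hm
    change laurentEval p (.ofAdd (l + ((Fintype.card K : ℤ) - 1) • a)) = 1
    rw [ofAdd_add, map_mul, hp l hl, one_mul, ← hcard, natCast_zsmul, ofAdd_nsmul, map_pow,
      ← Fintype.card_units, pow_card_eq_one]
  -- Over K, triviality on L and on L' are the same condition.
  have hrange : Y = Set.range
      (fun χ : LatticeQuotient v L' →* Kˣ => toricMkUnits F v (characterPoint ρ χ)) := by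
    rw [hY, range_toricMkUnits_characterPoint F hL'A hρ]
    ext x
    rw [mem_rationalZeros_latticeIdeal_inter_torusPoints_iff hexact hL]
    exact ⟨fun ⟨p, hp, hx⟩ => ⟨p, htriv p hp, hx⟩,
      fun ⟨p, hp, hx⟩ => ⟨p, fun m hm => hp m (hLL' hm), hx⟩⟩
  have hfin : Finite (LatticeQuotient v L') :=
    finite_latticeQuotient (Nat.sub_pos_of_lt Fintype.one_lt_card) hpow
  have henough : HasEnoughRootsOfUnity K (Monoid.exponent (LatticeQuotient v L')) :=
    hasEnoughRootsOfUnity_of_exponent_dvd K (exponent_latticeQuotient_dvd hpow)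
  refine ⟨le_antisymm (Ideal.span_le.2 ?_) (Ideal.span_le.2 ?_), ?_, ?_⟩
  · rintro f ⟨hf, hvan⟩
    refine mem_latticeIdeal_of_forall_characterPoint hexact hρ hf fun χ => ?_
    exact (vanishesAt_toricMkUnits hexact hf _).1 (hvan _ (hrange ▸ ⟨χ, rfl⟩))
  · rintro _ ⟨m, hm, rfl⟩
    have hhom : IsCoxHomogeneous β (latticeBinomial K m) :=
      isCoxHomogeneous_latticeBinomial ((hexact m).2 (hL'A hm))
    refine Ideal.subset_span ⟨hhom, fun x hx => ?_⟩
    rw [hrange, range_toricMkUnits_characterPoint F hL'A hρ] at hx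
    obtain ⟨p, hp, rfl⟩ := hx
    exact (vanishesAt_toricMkUnits hexact hhom p).2 ((aeval_latticeBinomial p m).2 (hp m hm))
  · rw [hrange]
    exact Set.finite_range _
  · rw [hrange, Set.ncard_range_of_injective (toricMkUnits_characterPoint_injective F hρ)]
    exact CommGroup.card_monoidHom_of_hasEnoughRootsOfUnity (LatticeQuotient v L') K
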